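/- Let $1\le M\le N$ be integers, $p\in\mathbb Z$, and $0<N_c\le N$ a real number. For $i=0,\dots,N-1$ let $\mathbf H_i=\mathrm{diag}\big(e^{2\pi j\, i p k/M}\big)_{k=0}^{M-1}$, $\mathbf D_i=\mathrm{diag}\big(e^{-2\pi j\, i r/N}\big)_{r=0}^{N-1}$, and let $\bar{\mathbf A}\in\mathbb C^{M\times N}$ have entries $\bar{\mathbf A}_{k,r}=\frac{1}{\sqrt{M N_c}}\,e^{-2\pi j\, r k/N}$ ($0\le k<M$, $0\le r<N$). Let $\gamma_0,\dots,\gamma_{N-1},\xi_0,\dots,\xi_{N-1}$ be jointly independent real random variables with $P(\gamma_i=1)=N_c/N$, $P(\gamma_i=0)=1-N_c/N$ and $P(\xi_i=1)=P(\xi_i=-1)=\tfrac12$, put $c_i=\gamma_i\xi_i$, and let $$\mathbf A=\sum_{i=0}^{N-1}c_i\,\mathbf H_i\bar{\mathbf A}\mathbf D_i\in\mathbb C^{M\times N}.$$ Write $\|\cdot\|_{op}$ for the spectral norm (largest singular value). If $N_c\ge\frac49\log(N+M)$, then $$P\left(\|\mathbf A\|_{op}\ge 2\sqrt{\frac{N\log(N+M)}{M}}\right)\le\left(\frac1{N+M}\right)^{\alpha_2-1},\qquad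 \alpha_2=\frac{2}{1+\frac23\sqrt{\frac{\log(N+M)}{N_c}}}.$$ In addition (whether or not $N_c\ge\frac49\log(N+M)$), $\|\mathbf A\|_{op}$ is integrable and $$E\|\mathbf A\|_{op}\le\sqrt{\frac{2N}{M}\log(N+M)}+\frac{\log(N+M)}{3}\sqrt{\frac{N}{M N_c}}.$$ -/

import Mathlib

open MeasureTheory ProbabilityTheory
open scoped Matrix.Norms.L2Operator

noncomputable section

namespace MultiChirp

/-- The `M × N` matrix with `(k, r)` entry `exp(-2πj r k / N) / √(M N_c)`: the samples of the tones
of the `N` delay bins. -/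
def toneMatrix (M N : ℕ) (Nc : ℝ) : Matrix (Fin M) (Fin N) ℂ :=
  Matrix.of fun k r =>
    ((1 / √((M : ℝ) * Nc) : ℝ) : ℂ) *
      Complex.exp (-(2 * Real.pi * Complex.I * ((r : ℕ) * (k : ℕ) / (N : ℂ))))

/-- The diagonal `M × M` matrix with entries `exp(2πj i p k / M)`, `k = 0, …, M - 1`. -/
def freqShift (M : ℕ) (p : ℤ) (i : ℕ) : Matrix (Fin M) (Fin M) ℂ :=
  Matrix.diagonal fun k =>
    Complex.exp (2 * Real.pi * Complex.I * ((i : ℂ) * (p : ℂ) * (k : ℕ) / (M : ℂ)))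

/-- The diagonal `N × N` matrix with entries `exp(-2πj i r / N)`, `r = 0, …, N - 1`. -/
def delayPhase (N : ℕ) (i : ℕ) : Matrix (Fin N) (Fin N) ℂ :=
  Matrix.diagonal fun r =>
    Complex.exp (-(2 * Real.pi * Complex.I * ((i : ℂ) * (r : ℕ) / (N : ℂ))))

/-- The measurement matrix `A = ∑ i, c i • (H i * Ā * D i)` with coefficients `c`. -/
def measurementMatrix (M N : ℕ) (Nc : ℝ) (p : ℤ) (c : Fin N → ℝ) : Matrix (Fin M) (Fin N) ℂ :=
  ∑ i : Fin N, (c i : ℂ) • (freqShift M p i * toneMatrix M N Nc * delayPhase N i)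

/-- The exponent `α₂ = 2 / (1 + (2/3) √(log (N + M) / N_c))`. -/
def alphaTwo (M N : ℕ) (Nc : ℝ) : ℝ :=
  2 / (1 + 2 / 3 * √(Real.log ((N : ℝ) + M) / Nc))

end MultiChirp

end

/-!
The proof is the matrix Laplace transform method. Put `ρ = √(N / (M N_c))`. Since `M ≤ N`, the rows
of the tone matrix are orthogonal, so every summand `B i = H i * Ā * D i` satisfies
`B i * (B i)ᴴ = ρ ^ 2 • 1` (`chirp_mul_conjTranspose`), and its Hermitian dilation has norm at most
`ρ`. For a rectangular matrix `A` with dilation `H`, the number `exp (θ ‖A‖)` is at most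
`tr exp (θ H)`, because the spectrum of `H` is symmetric and `‖A‖ ≤ ‖H‖`
(`exp_norm_le_re_trace_exp`).

It remains to bound the expectation of `tr exp (∑ i, c i • X i)` for Hermitian `X i` with
`‖X i‖ ≤ r` and independent centred coefficients `c i ∈ {-1, 0, 1}` with `E (c i) ^ 2 = q`. By the
Golden–Thompson inequality `tr exp (Y + c X) ≤ tr (exp Y * exp (c X))`, and
`exp (c X) = 1 + c ^ 2 (cosh X - 1) + c sinh X` with `cosh X ≤ cosh r`; the term linear in `c` has
mean zero, so each summand costs a factor `1 + q (cosh r - 1)`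
(`integral_re_trace_exp_sum_le`). The Golden–Thompson inequality, rather than Lieb's concavity
theorem, suffices for these constants because the bound on `E (c i • X i) ^ 2` is the same for
every `i`: with `q = N_c / N` and `r = θ ρ` the product of the `N` factors is at most
`exp (N_c (cosh (θ ρ) - 1))`, and `cosh x - 1 ≤ x ^ 2 / 2 / (1 - x / 3)` turns this into Bernstein's
bound with variance `N_c ρ ^ 2 = N / M` and scale `ρ`. The tail bound is then Chernoff's
(`bernstein_tail`), the bound on the mean is Jensen's (`bernstein_mean`).

The Golden–Thompson inequality comes from the Lie product formula and the inequality
`|tr (P Q) ^ (2 ^ k)| ≤ |tr (P ^ (2 ^ k) Q ^ (2 ^ k))|` for Hermitian `P`, `Q`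
(`norm_trace_pow_le_and`).
-/

namespace MultiChirp

open Matrix Filter Topology

/-! ### Traces of powers of products of matrices -/

section TracePowers

variable {n : Type*} [Fintype n] [DecidableEq n]

lemma trace_mul_pow_comm (A B : Matrix n n ℂ) (m : ℕ) :
    trace ((A * B) ^ m) = trace ((B * A) ^ m) := by
  cases m with
  | zero => simp
  | succ m =>
    have h : (A * B) ^ (m + 1) = A * ((B * A) ^ m * B) := by
      induction m with
      | zero => simp
      | succ m ih => rw [pow_succ, ih, pow_succ (B * A)]; simp only [mul_assoc]
    rw [h, trace_mul_comm, pow_succ, mul_assoc]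

omit [DecidableEq n] in
lemma trace_mul_conjTranspose_eq (A : Matrix n n ℂ) :
    trace (A * Aᴴ) = ((∑ i, ∑ j, ‖A i j‖ ^ 2 : ℝ) : ℂ) := by
  simp only [trace, diag_apply, mul_apply, conjTranspose_apply, Complex.ofReal_sum]
  refine Finset.sum_congr rfl fun i _ => Finset.sum_congr rfl fun j _ => ?_
  rw [Complex.star_def, Complex.mul_conj, Complex.normSq_eq_norm_sq]

omit [DecidableEq n] in
lemma norm_trace_mul_conjTranspose (A : Matrix n n ℂ) :
    ‖trace (A * Aᴴ)‖ = ∑ i, ∑ j, ‖A i j‖ ^ 2 := by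
  rw [trace_mul_conjTranspose_eq, Complex.norm_real, Real.norm_of_nonneg]
  positivity

omit [DecidableEq n] in
/-- The Cauchy–Schwarz inequality for the trace pairing, combined with the inequality of the
arithmetic and geometric means. -/
lemma norm_trace_mul_le (A B : Matrix n n ℂ) :
    ‖trace (A * B)‖ ≤ (‖trace (A * Aᴴ)‖ + ‖trace (B * Bᴴ)‖) / 2 := by
  rw [norm_trace_mul_conjTranspose, norm_trace_mul_conjTranspose,
    Finset.sum_comm (f := fun i j => ‖B i j‖ ^ 2), ← Finset.sum_add_distrib, Finset.sum_div]
  simp only [trace, diag_apply, mul_apply]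
  refine (norm_sum_le _ _).trans (Finset.sum_le_sum fun i _ => ?_)
  rw [← Finset.sum_add_distrib, Finset.sum_div]
  refine (norm_sum_le _ _).trans (Finset.sum_le_sum fun j _ => ?_)
  rw [norm_mul]
  nlinarith [sq_nonneg (‖A i j‖ - ‖B j i‖)]

/-- Two inequalities proved by a simultaneous induction: each one at exponent `2 ^ (k + 1)` follows
from both at exponent `2 ^ k`. -/
lemma norm_trace_pow_le_and (k : ℕ) :
    (∀ X : Matrix n n ℂ, ‖trace (X ^ 2 ^ (k + 1))‖ ≤ ‖trace ((X * Xᴴ) ^ 2 ^ k)‖) ∧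
    ∀ P Q : Matrix n n ℂ, P.IsHermitian → Q.IsHermitian →
      ‖trace ((P * Q) ^ 2 ^ k)‖ ≤ ‖trace (P ^ 2 ^ k * Q ^ 2 ^ k)‖ := by
  induction k with
  | zero =>
    refine ⟨fun X => ?_, fun P Q _ _ => by simp⟩
    have := norm_trace_mul_le X X
    simpa [sq] using this
  | succ k ih =>
    obtain ⟨hC, hD⟩ := ih
    refine ⟨fun X => ?_, fun P Q hP hQ => ?_⟩
    · have hP : (X * Xᴴ).IsHermitian := isHermitian_mul_conjTranspose_self X
      have hQ : (Xᴴ * X).IsHermitian := isHermitian_conjTranspose_mul_self X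
      calc ‖trace (X ^ 2 ^ (k + 1 + 1))‖ = ‖trace ((X * X) ^ 2 ^ (k + 1))‖ := by
            rw [← sq, ← pow_mul, ← pow_succ']
        _ ≤ ‖trace (((X * X) * (X * X)ᴴ) ^ 2 ^ k)‖ := hC _
        _ = ‖trace (((X * Xᴴ) * (Xᴴ * X)) ^ 2 ^ k)‖ := by
            rw [conjTranspose_mul, mul_assoc X X, trace_mul_pow_comm]
            simp only [mul_assoc]
        _ ≤ ‖trace ((X * Xᴴ) ^ 2 ^ k * (Xᴴ * X) ^ 2 ^ k)‖ := hD _ _ hP hQ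
        _ ≤ _ := norm_trace_mul_le _ _
        _ = ‖trace ((X * Xᴴ) ^ 2 ^ (k + 1))‖ := by
            rw [(hP.pow _).eq, (hQ.pow _).eq, ← pow_add, ← pow_add, ← two_mul, ← pow_succ',
              trace_mul_pow_comm Xᴴ X]
            ring
    · calc ‖trace ((P * Q) ^ 2 ^ (k + 1))‖ ≤ ‖trace (((P * Q) * (P * Q)ᴴ) ^ 2 ^ k)‖ := hC _
        _ = ‖trace ((P ^ 2 * Q ^ 2) ^ 2 ^ k)‖ := by
            rw [conjTranspose_mul, hP.eq, hQ.eq, mul_assoc P Q, trace_mul_pow_comm P,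
              trace_mul_pow_comm (P ^ 2)]
            simp only [mul_assoc, sq]
        _ ≤ _ := hD _ _ (hP.pow 2) (hQ.pow 2)
        _ = _ := by rw [← pow_mul, ← pow_mul, ← pow_succ']

end TracePowers

/-! ### The Lie product formula -/

section LieProduct

variable {𝔸 : Type*} [NormedRing 𝔸] [NormOneClass 𝔸]

lemma norm_pow_sub_pow_le {K : ℝ} {x y : 𝔸} (hx : ‖x‖ ≤ K) (hy : ‖y‖ ≤ K) (n : ℕ) :
    ‖x ^ (n + 1) - y ^ (n + 1)‖ ≤ (n + 1) * K ^ n * ‖x - y‖ := by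
  have hK : 0 ≤ K := (norm_nonneg _).trans hx
  induction n with
  | zero => simp
  | succ n ih =>
    have h : x ^ (n + 1 + 1) - y ^ (n + 1 + 1) =
        x * (x ^ (n + 1) - y ^ (n + 1)) + (x - y) * y ^ (n + 1) := by
      rw [pow_succ' x (n + 1), pow_succ' y (n + 1)]; noncomm_ring
    rw [h]
    calc _ ≤ ‖x‖ * ‖x ^ (n + 1) - y ^ (n + 1)‖ + ‖x - y‖ * ‖y‖ ^ (n + 1) :=
          (norm_add_le _ _).trans (add_le_add (norm_mul_le _ _)
            ((norm_mul_le _ _).trans (by gcongr; exact norm_pow_le _ _)))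
      _ ≤ K * ((n + 1) * K ^ n * ‖x - y‖) + ‖x - y‖ * K ^ (n + 1) := by gcongr
      _ = _ := by push_cast; ring

variable [NormedAlgebra ℝ 𝔸]

lemma norm_exp_le_exp_norm (a : 𝔸) : ‖NormedSpace.exp a‖ ≤ Real.exp ‖a‖ := by
  rw [NormedSpace.exp_eq_tsum ℝ, Real.exp_eq_exp_ℝ, NormedSpace.exp_eq_tsum_div]
  refine tsum_of_norm_bounded (NormedSpace.expSeries_div_summable ‖a‖).hasSum fun k => ?_
  rw [norm_smul, norm_inv, RCLike.norm_natCast, inv_mul_eq_div]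
  gcongr
  exact norm_pow_le a k

/-- The **Lie product formula** in a Banach algebra. -/
theorem tendsto_exp_mul_exp_pow [CompleteSpace 𝔸] (a b : 𝔸) :
    Tendsto (fun n : ℕ => (NormedSpace.exp ((n : ℝ)⁻¹ • a) * NormedSpace.exp ((n : ℝ)⁻¹ • b)) ^ n)
      atTop (𝓝 (NormedSpace.exp (a + b))) := by
  -- The difference `h` vanishes to second order at `0`, so `n * h (1 / n) → 0`; the telescoping
  -- estimate for a difference of `n`-th powers loses only a factor `n`.
  let h : ℝ → 𝔸 := fun t => NormedSpace.exp (t • a) * NormedSpace.exp (t • b) -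
    NormedSpace.exp (t • (a + b))
  have hd : HasDerivAt h 0 0 := by
    have := ((hasDerivAt_exp_smul_const a (0 : ℝ)).mul
      (hasDerivAt_exp_smul_const b (0 : ℝ))).sub (hasDerivAt_exp_smul_const (a + b) (0 : ℝ))
    exact this.congr_deriv (by simp)
  have hs := hd.tendsto_slope_zero
  have h0 : Tendsto (fun n : ℕ => (n : ℝ) • h (n : ℝ)⁻¹) atTop (𝓝 0) := by
    have hn : Tendsto (fun n : ℕ => (n : ℝ)⁻¹) atTop (𝓝[≠] 0) :=
      tendsto_nhdsWithin_iff.2 ⟨tendsto_inv_atTop_nhds_zero_nat,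
        (eventually_gt_atTop 0).mono fun n hn => by simp [hn.ne']⟩
    simpa [h, Function.comp_def] using hs.comp hn
  rw [tendsto_iff_norm_sub_tendsto_zero]
  have hb : Tendsto (fun n : ℕ => Real.exp (‖a‖ + ‖b‖) * ‖(n : ℝ) • h (n : ℝ)⁻¹‖) atTop (𝓝 0) := by
    simpa using (h0.norm).const_mul (Real.exp (‖a‖ + ‖b‖))
  refine squeeze_zero' (Eventually.of_forall fun _ => norm_nonneg _) ?_ hb
  filter_upwards [eventually_gt_atTop 0] with n hn
  obtain ⟨m, rfl⟩ : ∃ m, n = m + 1 := ⟨n - 1, by omega⟩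
  set t : ℝ := ((m + 1 : ℕ) : ℝ)⁻¹ with ht
  have ht0 : 0 ≤ t := by positivity
  have hmt : ((m + 1 : ℕ) : ℝ) * t = 1 := mul_inv_cancel₀ (by positivity)
  have hpow : NormedSpace.exp (a + b) = NormedSpace.exp (t • (a + b)) ^ (m + 1) := by
    let _ : NormedAlgebra ℚ 𝔸 := NormedAlgebra.restrictScalars ℚ ℝ 𝔸
    rw [← NormedSpace.exp_nsmul, ← Nat.cast_smul_eq_nsmul ℝ, smul_smul, hmt, one_smul]
  have hx : ‖NormedSpace.exp (t • a) * NormedSpace.exp (t • b)‖ ≤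
      Real.exp (t * (‖a‖ + ‖b‖)) := by
    refine (norm_mul_le _ _).trans ?_
    rw [mul_add, Real.exp_add]
    gcongr
    · refine (norm_exp_le_exp_norm _).trans ?_
      rw [norm_smul, Real.norm_of_nonneg ht0]
    · refine (norm_exp_le_exp_norm _).trans ?_
      rw [norm_smul, Real.norm_of_nonneg ht0]
  have hy : ‖NormedSpace.exp (t • (a + b))‖ ≤ Real.exp (t * (‖a‖ + ‖b‖)) := by
    refine (norm_exp_le_exp_norm _).trans ?_
    rw [norm_smul, Real.norm_of_nonneg ht0]
    gcongr
    exact norm_add_le a b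
  rw [hpow]
  refine (norm_pow_sub_pow_le hx hy m).trans ?_
  rw [norm_smul, Real.norm_of_nonneg (by positivity), ← Real.exp_nat_mul]
  have : (m : ℝ) * (t * (‖a‖ + ‖b‖)) ≤ ‖a‖ + ‖b‖ := by
    have h1 : (m : ℝ) * t ≤ 1 := by push_cast at hmt; nlinarith
    nlinarith [norm_nonneg a, norm_nonneg b]
  have h2 := Real.exp_le_exp.2 this
  push_cast
  calc _ = Real.exp (m * (t * (‖a‖ + ‖b‖))) * ((m + 1) * ‖h t‖) := by ring
    _ ≤ _ := by gcongr

end LieProduct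

/-! ### The Golden–Thompson inequality -/

section GoldenThompson

variable {n : Type*} [Fintype n] [DecidableEq n]

/-- The **Golden–Thompson inequality**, with norms on both sides. -/
theorem norm_trace_exp_add_le {A B : Matrix n n ℂ} (hA : A.IsHermitian) (hB : B.IsHermitian) :
    ‖trace (NormedSpace.exp (A + B))‖ ≤ ‖trace (NormedSpace.exp A * NormedSpace.exp B)‖ := by
  cases isEmpty_or_nonempty n
  · simp [trace]
  have hexp : ∀ (k : ℕ) (C : Matrix n n ℂ),
      NormedSpace.exp (((2 ^ k : ℕ) : ℝ)⁻¹ • C) ^ 2 ^ k = NormedSpace.exp C := fun k C => by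
    rw [← Matrix.exp_nsmul, ← Nat.cast_smul_eq_nsmul ℝ, smul_smul, mul_inv_cancel₀ (by positivity),
      one_smul]
  have hherm : ∀ (t : ℝ) {C : Matrix n n ℂ}, C.IsHermitian →
      (NormedSpace.exp (t • C)).IsHermitian := fun t C hC =>
    Matrix.IsHermitian.exp (by simp [IsHermitian, conjTranspose_smul, hC.eq])
  -- The Lie product formula is used along the exponents `2 ^ k`.
  have h1 := (tendsto_exp_mul_exp_pow A B).comp (tendsto_pow_atTop_atTop_of_one_lt one_lt_two)
  have h2 := ((continuous_id.matrix_trace.norm).tendsto _).comp h1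
  refine le_of_tendsto h2 (Eventually.of_forall fun k => ?_)
  have := (norm_trace_pow_le_and k).2 _ _ (hherm ((2 ^ k : ℕ) : ℝ)⁻¹ hA)
    (hherm ((2 ^ k : ℕ) : ℝ)⁻¹ hB)
  rw [hexp, hexp] at this
  exact this

end GoldenThompson

/-! ### The trace exponential of a Hermitian matrix -/

section TraceExp

variable {n : Type*} [Fintype n] [DecidableEq n]

lemma exp_eq_mul_conjTranspose {A : Matrix n n ℂ} (hA : A.IsHermitian) :
    NormedSpace.exp A =
      NormedSpace.exp ((2⁻¹ : ℝ) • A) * (NormedSpace.exp ((2⁻¹ : ℝ) • A))ᴴ := by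
  have h : ((2⁻¹ : ℝ) • A).IsHermitian := by simp [IsHermitian, conjTranspose_smul, hA.eq]
  rw [h.exp.eq, ← Matrix.exp_add_of_commute _ _ (Commute.refl _), ← add_smul]
  norm_num

omit [DecidableEq n] in
lemma re_trace_mul_conjTranspose (A : Matrix n n ℂ) :
    (trace (A * Aᴴ)).re = ‖trace (A * Aᴴ)‖ := by
  rw [norm_trace_mul_conjTranspose, trace_mul_conjTranspose_eq, Complex.ofReal_re]

/-- The **Golden–Thompson inequality**. -/
theorem re_trace_exp_add_le {A B : Matrix n n ℂ} (hA : A.IsHermitian) (hB : B.IsHermitian) :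
    (trace (NormedSpace.exp (A + B))).re ≤ (trace (NormedSpace.exp A * NormedSpace.exp B)).re := by
  refine (Complex.re_le_norm _).trans ((norm_trace_exp_add_le hA hB).trans_eq ?_)
  have h : trace (NormedSpace.exp A * NormedSpace.exp B) =
      trace (((NormedSpace.exp ((2⁻¹ : ℝ) • A))ᴴ * NormedSpace.exp ((2⁻¹ : ℝ) • B)) *
        ((NormedSpace.exp ((2⁻¹ : ℝ) • A))ᴴ * NormedSpace.exp ((2⁻¹ : ℝ) • B))ᴴ) := by
    rw [exp_eq_mul_conjTranspose hA, exp_eq_mul_conjTranspose hB, conjTranspose_mul,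
      conjTranspose_conjTranspose, mul_assoc, trace_mul_comm]
    simp only [mul_assoc]
  rw [h, re_trace_mul_conjTranspose]

/-- The largest eigenvalue is controlled by the trace exponential, since all the summands
`exp λ` of the latter are positive. -/
lemma exp_le_re_trace_exp {A : Matrix n n ℂ} (hA : A.IsHermitian) {x : ℝ}
    (hx : x ∈ spectrum ℝ A) : Real.exp x ≤ (trace (NormedSpace.exp A)).re := by
  rw [hA.spectrum_real_eq_range_eigenvalues] at hx
  obtain ⟨i, rfl⟩ := hx
  have h : trace (NormedSpace.exp A) = ((∑ j, Real.exp (hA.eigenvalues j) : ℝ) : ℂ) := by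
    rw [← CFC.real_exp_eq_normedSpace_exp hA.isSelfAdjoint, hA.cfc_eq, IsHermitian.cfc,
      Unitary.conjStarAlgAut_apply, trace_mul_cycle, Unitary.coe_star_mul_self, one_mul,
      trace_diagonal]
    simp
  rw [h, Complex.ofReal_re]
  exact Finset.single_le_sum (f := fun j => Real.exp (hA.eigenvalues j))
    (fun j _ => (Real.exp_pos _).le) (Finset.mem_univ i)

open scoped MatrixOrder ComplexOrder in
/-- The operator inequality `2 cosh X ≤ 2 cosh ρ`, from the functional calculus. -/
lemma posSemidef_cosh_sub {X : Matrix n n ℂ} (hX : X.IsHermitian) {ρ : ℝ} (hρ : ‖X‖ ≤ ρ) :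
    (algebraMap ℝ (Matrix n n ℂ) (2 * Real.cosh ρ) -
      (NormedSpace.exp X + NormedSpace.exp (-X))).PosSemidef := by
  cases isEmpty_or_nonempty n
  · rw [Subsingleton.elim (algebraMap ℝ (Matrix n n ℂ) (2 * Real.cosh ρ) - _) 0]
    exact PosSemidef.zero
  have h : NormedSpace.exp X + NormedSpace.exp (-X) =
      cfc (fun x : ℝ => Real.exp x + Real.exp (-x)) X := by
    rw [cfc_add X Real.exp (fun x => Real.exp (-x)) (by fun_prop) (by fun_prop),
      cfc_comp_neg Real.exp X (by fun_prop) hX.isSelfAdjoint,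
      CFC.real_exp_eq_normedSpace_exp hX.isSelfAdjoint,
      CFC.real_exp_eq_normedSpace_exp hX.neg.isSelfAdjoint]
  rw [← Matrix.le_iff, h]
  refine cfc_le_algebraMap _ _ _ (fun x hx => ?_) (by fun_prop) hX.isSelfAdjoint
  have hx' : |x| ≤ |ρ| := ((spectrum.norm_le_norm_of_mem hx).trans hρ).trans (le_abs_self _)
  have := Real.cosh_le_cosh.2 hx'
  rw [Real.cosh_eq x] at this
  linarith

open scoped ComplexOrder in
lemma re_trace_exp_mul_cosh_le {X Y : Matrix n n ℂ} (hX : X.IsHermitian) (hY : Y.IsHermitian)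
    {ρ : ℝ} (hρ : ‖X‖ ≤ ρ) :
    (trace (NormedSpace.exp Y * (NormedSpace.exp X + NormedSpace.exp (-X)))).re ≤
      2 * Real.cosh ρ * (trace (NormedSpace.exp Y)).re := by
  have h := ((posSemidef_cosh_sub hX hρ).conjTranspose_mul_mul_same
    (NormedSpace.exp ((2⁻¹ : ℝ) • Y))).trace_nonneg
  rw [trace_mul_comm, ← mul_assoc, ← exp_eq_mul_conjTranspose hY, mul_sub, trace_sub,
    Algebra.algebraMap_eq_smul_one, mul_smul_comm, mul_one, trace_smul] at h
  have := (Complex.le_def.1 h).1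
  simpa using this

/-- One step of the matrix Laplace transform method: adding a term `c • X` with `c ∈ {-1, 0, 1}`
multiplies the trace exponential by at most `1 + c ^ 2 * (cosh ρ - 1)`, up to a term that is linear
in `c`. -/
lemma re_trace_exp_add_smul_le {X Y : Matrix n n ℂ} (hX : X.IsHermitian) (hY : Y.IsHermitian)
    {ρ : ℝ} (hρ : ‖X‖ ≤ ρ) {c : ℝ} (hc : c = -1 ∨ c = 0 ∨ c = 1) :
    (trace (NormedSpace.exp (Y + c • X))).re ≤
      (trace (NormedSpace.exp Y)).re * (1 + c ^ 2 * (Real.cosh ρ - 1)) +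
        c * ((trace (NormedSpace.exp Y * (NormedSpace.exp X - NormedSpace.exp (-X)))).re / 2) := by
  have h := re_trace_exp_mul_cosh_le hX hY hρ
  simp only [mul_add, mul_sub, trace_add, trace_sub, Complex.add_re, Complex.sub_re] at h ⊢
  rcases hc with rfl | rfl | rfl
  · have := re_trace_exp_add_le hY hX.neg
    rw [neg_one_smul]
    linarith
  · simp
  · have := re_trace_exp_add_le hY hX
    rw [one_smul]
    linarith

end TraceExp

/-! ### Expectation of the trace exponential of a random sum -/

section Expectation

variable {Ω : Type*} [MeasurableSpace Ω] {μ : Measure Ω} [IsProbabilityMeasure μ]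
  {ι : Type*} {c : ι → Ω → ℝ}

lemma integrable_comp_of_continuous [Fintype ι] (hcm : ∀ i, Measurable (c i))
    (hbd : ∀ i, ∀ᵐ ω ∂μ, |c i ω| ≤ 1) {F : (ι → ℝ) → ℝ} (hF : Continuous F) :
    Integrable (fun ω => F fun i => c i ω) μ := by
  obtain ⟨K, hK⟩ := (isCompact_closedBall (0 : ι → ℝ) 1).exists_bound_of_continuousOn
    hF.continuousOn
  refine Integrable.of_bound
    (hF.measurable.comp (measurable_pi_lambda _ hcm)).aestronglyMeasurable K ?_
  filter_upwards [ae_all_iff.2 hbd] with ω hω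
  refine hK _ ?_
  rw [mem_closedBall_zero_iff, pi_norm_le_iff_of_nonneg zero_le_one]
  exact hω

variable {n : Type*} [Fintype n] [DecidableEq n]

omit [Fintype n] [DecidableEq n] in
lemma continuous_sum_smul (s : Finset ι) (X : ι → Matrix n n ℂ) :
    Continuous fun a : ι → ℝ => ∑ i ∈ s, a i • X i := by
  fun_prop

omit [Fintype n] [DecidableEq n] in
lemma isHermitian_sum_smul (s : Finset ι) {X : ι → Matrix n n ℂ} (hX : ∀ i, (X i).IsHermitian)
    (a : ι → ℝ) : (∑ i ∈ s, a i • X i).IsHermitian := by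
  simp [IsHermitian, conjTranspose_sum, conjTranspose_smul, (hX _).eq]

lemma continuous_re_trace_exp_mul (B : Matrix n n ℂ) :
    Continuous fun A : Matrix n n ℂ => (trace (NormedSpace.exp A * B)).re := by
  have : Continuous (NormedSpace.exp : Matrix n n ℂ → Matrix n n ℂ) :=
    let _ : NormedAlgebra ℚ (Matrix n n ℂ) := .restrictScalars ℚ ℂ _
    NormedSpace.exp_continuous
  fun_prop

/-- The matrix moment generating function bound, by induction on the set of summands. Each step uses
the Golden–Thompson inequality pointwise and takes the expectation over the new coefficient, whose
mean vanishes. -/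
theorem integral_re_trace_exp_sum_le [DecidableEq ι] (hcm : ∀ i, Measurable (c i))
    (hc : ∀ i, ∀ᵐ ω ∂μ, c i ω = -1 ∨ c i ω = 0 ∨ c i ω = 1)
    (hind : ∀ (s : Finset ι) (j : ι), j ∉ s → IndepFun (fun ω (i : s) => c i ω) (c j) μ)
    {q : ℝ} (hc1 : ∀ i, ∫ ω, c i ω ∂μ = 0) (hc2 : ∀ i, ∫ ω, c i ω ^ 2 ∂μ = q)
    {X : ι → Matrix n n ℂ} (hX : ∀ i, (X i).IsHermitian) {ρ : ℝ} (hρ : ∀ i, ‖X i‖ ≤ ρ)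
    (s : Finset ι) :
    ∫ ω, (trace (NormedSpace.exp (∑ i ∈ s, c i ω • X i))).re ∂μ ≤
      Fintype.card n * (1 + q * (Real.cosh ρ - 1)) ^ s.card := by
  have hbd : ∀ i, ∀ᵐ ω ∂μ, |c i ω| ≤ 1 := fun i => by
    filter_upwards [hc i] with ω hω
    rcases hω with h | h | h <;> simp [h]
  induction s using Finset.induction_on with
  | empty => simp
  | insert j s hj ih =>
    have hq : 0 ≤ q := hc2 j ▸ integral_nonneg fun ω => sq_nonneg _
    let Y : (s → ℝ) → Matrix n n ℂ := fun a => ∑ i, a i • X i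
    have hY : ∀ ω, ∑ i ∈ s, c i ω • X i = Y fun i => c i ω := fun ω =>
      (Finset.sum_coe_sort s fun i => c i ω • X i).symm
    have hYc : Continuous Y := continuous_sum_smul _ _
    have hYh : ∀ a, (Y a).IsHermitian := isHermitian_sum_smul _ fun i => hX i
    let F : (s → ℝ) → ℝ := fun a => (trace (NormedSpace.exp (Y a))).re
    have hF : Continuous F := by
      simpa [Function.comp_def] using (continuous_re_trace_exp_mul (1 : Matrix n n ℂ)).comp hYc
    let G : (s → ℝ) → ℝ := fun a =>
      (trace (NormedSpace.exp (Y a) * (NormedSpace.exp (X j) - NormedSpace.exp (-X j)))).re / 2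
    have hG : Continuous G := ((continuous_re_trace_exp_mul _).comp hYc).div_const 2
    have hFi : Integrable (fun ω => F fun i => c i ω) μ :=
      integrable_comp_of_continuous (ι := s) (fun i => hcm i) (fun i => hbd i) hF
    have hGi : Integrable (fun ω => G fun i => c i ω) μ :=
      integrable_comp_of_continuous (ι := s) (fun i => hcm i) (fun i => hbd i) hG
    have hci : ∀ {f : ℝ → ℝ}, Continuous f → Integrable (fun ω => f (c j ω)) μ := fun hf =>
      integrable_comp_of_continuous (ι := Unit) (fun _ => hcm j) (fun _ => hbd j)
        (hf.comp (continuous_apply ()))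
    have hF1 : IndepFun (fun ω => F fun i => c i ω)
        (fun ω => 1 + c j ω ^ 2 * (Real.cosh ρ - 1)) μ :=
      (hind s j hj).comp (ψ := fun x : ℝ => 1 + x ^ 2 * (Real.cosh ρ - 1)) hF.measurable
        (by fun_prop)
    have hG1 : IndepFun (c j) (fun ω => G fun i => c i ω) μ :=
      ((hind s j hj).symm.comp measurable_id hG.measurable)
    have hci2 : Integrable (fun ω => 1 + c j ω ^ 2 * (Real.cosh ρ - 1)) μ :=
      hci (f := fun x => 1 + x ^ 2 * (Real.cosh ρ - 1)) (by fun_prop)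
    have hI1 : Integrable (fun ω => (F fun i => c i ω) *
        (1 + c j ω ^ 2 * (Real.cosh ρ - 1))) μ := hF1.integrable_mul hFi hci2
    have hI2 : Integrable (fun ω => c j ω * G fun i => c i ω) μ :=
      hG1.integrable_mul (hci continuous_id) hGi
    have hmain : ∫ ω, (trace (NormedSpace.exp (∑ i ∈ insert j s, c i ω • X i))).re ∂μ ≤
        ∫ ω, ((F fun i => c i ω) * (1 + c j ω ^ 2 * (Real.cosh ρ - 1)) +
          c j ω * G fun i => c i ω) ∂μ := by
      refine integral_mono_ae ?_ (hI1.add hI2) ?_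
      · let S : Finset ι := insert j s
        have hS : ∀ ω, ∑ i ∈ insert j s, c i ω • X i = ∑ i : S, c i ω • X i := fun ω =>
          (Finset.sum_coe_sort S fun i => c i ω • X i).symm
        simp only [hS]
        refine integrable_comp_of_continuous (ι := S) (c := fun i => c i)
          (F := fun a => (trace (NormedSpace.exp (∑ i, a i • X i))).re)
          (fun i => hcm i) (fun i => hbd i) ?_
        simpa [Function.comp_def] using (continuous_re_trace_exp_mul (1 : Matrix n n ℂ)).comp
          (continuous_sum_smul (Finset.univ : Finset S) fun i => X i)
      · filter_upwards [hc j] with ω hω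
        rw [Finset.sum_insert hj, add_comm, hY]
        exact re_trace_exp_add_smul_le (hX j) (hYh _) (hρ j) hω
    refine hmain.trans ?_
    rw [integral_add hI1 hI2, hF1.integral_fun_mul_eq_mul_integral hFi.1 hci2.1,
      hG1.integral_fun_mul_eq_mul_integral (hcm j).aestronglyMeasurable hGi.1, hc1 j, zero_mul,
      add_zero, integral_add (integrable_const _) (hci (f := fun x => x ^ 2 * _) (by fun_prop)),
      integral_mul_const, hc2 j, Finset.card_insert_of_notMem hj, pow_succ, ← mul_assoc]
    have h1 : 0 ≤ 1 + q * (Real.cosh ρ - 1) := by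
      have := Real.one_le_cosh ρ
      have : 0 ≤ q * (Real.cosh ρ - 1) := mul_nonneg hq (by linarith)
      linarith
    simp only [hY] at ih
    simpa using mul_le_mul_of_nonneg_right ih h1

end Expectation

/-! ### The Hermitian dilation -/

section Dilation

variable {m n : Type*} [Fintype m] [Fintype n] [DecidableEq m] [DecidableEq n]

/-- The Hermitian dilation of a rectangular matrix `A`, with blocks `0`, `A`, `Aᴴ`, `0`. -/
noncomputable def hermitianDilation (A : Matrix m n ℂ) : Matrix (m ⊕ n) (m ⊕ n) ℂ :=
  fromBlocks 0 A Aᴴ 0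

omit [Fintype m] [Fintype n] [DecidableEq m] [DecidableEq n] in
lemma isHermitian_hermitianDilation (A : Matrix m n ℂ) : (hermitianDilation A).IsHermitian := by
  simp [hermitianDilation, IsHermitian, fromBlocks_conjTranspose]

lemma norm_le_norm_hermitianDilation (A : Matrix m n ℂ) : ‖A‖ ≤ ‖hermitianDilation A‖ := by
  cases isEmpty_or_nonempty m
  · rw [Subsingleton.elim A 0, norm_zero]; exact norm_nonneg _
  cases isEmpty_or_nonempty n
  · rw [Subsingleton.elim A 0, norm_zero]; exact norm_nonneg _
  -- `A` is a compression of its dilation by the isometric embeddings `E` and `F` of the blocks.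
  let E : Matrix (m ⊕ n) m ℂ := fromRows 1 0
  let F : Matrix (m ⊕ n) n ℂ := fromRows 0 1
  have hE : ‖E‖ = 1 := by
    have h := l2_opNorm_conjTranspose_mul_self E
    have h1 : Eᴴ * E = 1 := by simp [E, conjTranspose_fromRows_eq_fromCols_conjTranspose,
      fromCols_mul_fromRows]
    rw [h1, norm_one] at h
    nlinarith [norm_nonneg E]
  have hF : ‖F‖ = 1 := by
    have h := l2_opNorm_conjTranspose_mul_self F
    have h1 : Fᴴ * F = 1 := by simp [F, conjTranspose_fromRows_eq_fromCols_conjTranspose,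
      fromCols_mul_fromRows]
    rw [h1, norm_one] at h
    nlinarith [norm_nonneg F]
  have hA : A = Eᴴ * hermitianDilation A * F := by
    simp [E, F, hermitianDilation, conjTranspose_fromRows_eq_fromCols_conjTranspose,
      fromCols_mul_fromBlocks, fromCols_mul_fromRows]
  calc ‖A‖ = ‖Eᴴ * hermitianDilation A * F‖ := by rw [← hA]
    _ ≤ ‖Eᴴ‖ * ‖hermitianDilation A‖ * ‖F‖ := (l2_opNorm_mul _ _).trans (by
        gcongr; exact l2_opNorm_mul _ _)
    _ = ‖hermitianDilation A‖ := by rw [l2_opNorm_conjTranspose, hE, hF, one_mul, mul_one]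

lemma norm_hermitianDilation_le {A : Matrix m n ℂ} {ρ : ℝ} (hρ : 0 ≤ ρ)
    (hA : A * Aᴴ = (ρ ^ 2) • (1 : Matrix m m ℂ)) : ‖hermitianDilation A‖ ≤ ρ := by
  set H := hermitianDilation A with hH
  have hh : Hᴴ = H := isHermitian_hermitianDilation A
  -- From `H ^ 4 = ρ ^ 2 • H ^ 2` the C⋆-identity gives `‖H‖ ^ 4 = ρ ^ 2 * ‖H‖ ^ 2`.
  have h4 : (H * H) * (H * H) = (ρ ^ 2) • (H * H) := by
    have : Aᴴ * A * (Aᴴ * A) = (ρ ^ 2) • (Aᴴ * A) := by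
      rw [Matrix.mul_assoc, ← Matrix.mul_assoc A, hA]; simp
    simp [hH, hermitianDilation, fromBlocks_multiply, hA, fromBlocks_smul, this]
  have h2 : ‖H * H‖ = ‖H‖ * ‖H‖ := by
    simpa [hh] using l2_opNorm_conjTranspose_mul_self H
  have h5 : ‖(H * H) * (H * H)‖ = ‖H * H‖ * ‖H * H‖ := by
    have h := l2_opNorm_conjTranspose_mul_self (H * H)
    rwa [conjTranspose_mul, hh] at h
  rw [h4, norm_smul, h2, Real.norm_of_nonneg (sq_nonneg ρ)] at h5
  by_contra! hlt
  have : 0 < ‖H‖ := hρ.trans_lt hlt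
  have h6 : ρ ^ 2 = ‖H‖ * ‖H‖ := mul_right_cancel₀ (by positivity) h5
  nlinarith

/-- The spectrum of the dilation is symmetric about `0`, so its norm is an eigenvalue. -/
lemma norm_mem_spectrum_hermitianDilation [Nonempty m] (A : Matrix m n ℂ) :
    ‖hermitianDilation A‖ ∈ spectrum ℝ (hermitianDilation A) := by
  -- Conjugation by the involution `J` changes the sign of the dilation.
  let J : Matrix (m ⊕ n) (m ⊕ n) ℂ := fromBlocks 1 0 0 (-1)
  have hJ : J * J = 1 := by simp [J, fromBlocks_multiply]
  have hneg : J * hermitianDilation A * J = -hermitianDilation A := by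
    simp [J, hermitianDilation, fromBlocks_multiply, fromBlocks_neg]
  rcases CStarAlgebra.norm_or_neg_norm_mem_spectrum
    (isHermitian_hermitianDilation A).isSelfAdjoint with h | h
  · exact h
  · let u : (Matrix (m ⊕ n) (m ⊕ n) ℂ)ˣ := ⟨J, J, hJ, hJ⟩
    have h1 : spectrum ℝ (J * hermitianDilation A * J) = spectrum ℝ (hermitianDilation A) :=
      spectrum.units_conjugate (u := u)
    rw [hneg, ← spectrum.neg_eq] at h1
    rw [← h1]
    simpa using h

lemma exp_norm_le_re_trace_exp [Nonempty m] (A : Matrix m n ℂ) {θ : ℝ} (hθ : 0 ≤ θ) :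
    Real.exp (θ * ‖A‖) ≤ (trace (NormedSpace.exp (θ • hermitianDilation A))).re := by
  have h : θ • hermitianDilation A = hermitianDilation (θ • A) := by
    simp [hermitianDilation, fromBlocks_smul, conjTranspose_smul]
  rw [h]
  refine le_trans ?_ (exp_le_re_trace_exp (isHermitian_hermitianDilation _)
    (norm_mem_spectrum_hermitianDilation _))
  have := norm_le_norm_hermitianDilation (θ • A)
  rw [norm_smul, Real.norm_of_nonneg hθ] at this
  exact Real.exp_le_exp.2 this

end Dilation

/-! ### From the moment generating function to the tail and the mean -/

section Bernstein

/-- Termwise comparison of the power series of `cosh` with a geometric series, using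
`2 * 3 ^ (2 * k) ≤ (2 * k + 2)!`. -/
lemma cosh_sub_one_le {x : ℝ} (hx0 : 0 ≤ x) (hx3 : x < 3) :
    Real.cosh x - 1 ≤ x ^ 2 / 2 / (1 - x / 3) := by
  have h1 := (hasSum_nat_add_iff' 1).2 (Real.hasSum_cosh x)
  have hr : x ^ 2 / 9 < 1 := by nlinarith
  have h2 := (hasSum_geometric_of_lt_one (by positivity) hr).mul_left (x ^ 2 / 2)
  have h3 : Real.cosh x - 1 ≤ x ^ 2 / 2 * (1 - x ^ 2 / 9)⁻¹ := by
    simp only [Finset.range_one, Finset.sum_singleton, mul_zero, pow_zero, Nat.factorial_zero,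
      Nat.cast_one, div_one] at h1
    refine hasSum_le (fun k => ?_) h1 h2
    have hfac : (2 * 9 ^ k : ℝ) ≤ ((2 * (k + 1)).factorial : ℝ) := by
      have := Nat.factorial_mul_pow_le_factorial (m := 2) (n := 2 * k)
      rw [pow_mul] at this
      rw [show 2 * (k + 1) = 2 + 2 * k by ring]
      exact_mod_cast this
    calc x ^ (2 * (k + 1)) / ((2 * (k + 1)).factorial : ℝ) ≤ x ^ (2 * (k + 1)) / (2 * 9 ^ k) := by
          gcongr
      _ = x ^ 2 / 2 * (x ^ 2 / 9) ^ k := by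
          rw [div_pow, ← pow_mul, mul_add, pow_add]; field_simp
  refine h3.trans ?_
  rw [← div_eq_mul_inv]
  refine div_le_div_of_nonneg_left (by positivity) (by linarith) (by nlinarith)

variable {Ω : Type*} [MeasurableSpace Ω] {μ : Measure Ω} [IsProbabilityMeasure μ] {W : Ω → ℝ}
  {d v R : ℝ}

/-- Chernoff's method with the choice `θ = t / (v + R * t / 3)`, for a random variable whose moment
generating function satisfies Bernstein's bound with variance `v`, scale `R` and prefactor `d`. -/
lemma bernstein_tail (hv : 0 < v) (hR : 0 < R)
    (hint : ∀ θ : ℝ, Integrable (fun ω => Real.exp (θ * W ω)) μ)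
    (hmgf : ∀ θ : ℝ, 0 ≤ θ → θ * R < 3 →
      ∫ ω, Real.exp (θ * W ω) ∂μ ≤ d * Real.exp (θ ^ 2 * v / 2 / (1 - θ * R / 3)))
    {t : ℝ} (ht : 0 ≤ t) :
    μ.real {ω | t ≤ W ω} ≤ d * Real.exp (-(t ^ 2 / 2 / (v + R * t / 3))) := by
  have hD : 0 < v + R * t / 3 := by positivity
  have hθR : t / (v + R * t / 3) * R < 3 := by
    rw [div_mul_eq_mul_div, div_lt_iff₀ hD]; nlinarith
  refine (measure_ge_le_exp_mul_mgf t (div_nonneg ht hD.le) (hint _)).trans ?_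
  refine (mul_le_mul_of_nonneg_left (hmgf _ (div_nonneg ht hD.le) hθR)
    (Real.exp_pos _).le).trans_eq ?_
  rw [mul_left_comm, ← Real.exp_add]
  congr 2
  have h1 : 1 - t / (v + R * t / 3) * R / 3 = v / (v + R * t / 3) := by
    field_simp; ring
  rw [h1]
  field_simp
  ring

/-- Jensen's inequality turns Bernstein's bound on the moment generating function into a bound on
the mean; the optimal parameter is `θ = 1 / (R / 3 + √(v / (2 * log d)))`. -/
lemma bernstein_mean (hd : 1 < d) (hv : 0 < v) (hR : 0 < R) (hW : Integrable W μ)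
    (hint : ∀ θ : ℝ, Integrable (fun ω => Real.exp (θ * W ω)) μ)
    (hmgf : ∀ θ : ℝ, 0 ≤ θ → θ * R < 3 →
      ∫ ω, Real.exp (θ * W ω) ∂μ ≤ d * Real.exp (θ ^ 2 * v / 2 / (1 - θ * R / 3))) :
    ∫ ω, W ω ∂μ ≤ √(2 * v * Real.log d) + R * Real.log d / 3 := by
  have hL : 0 < Real.log d := Real.log_pos hd
  set L := Real.log d with hLdef
  set s := √(v / (2 * L)) with hs
  have hs0 : 0 < s := Real.sqrt_pos.2 (by positivity)
  have hs2 : s ^ 2 = v / (2 * L) := Real.sq_sqrt (by positivity)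
  have hv' : v = 2 * L * s ^ 2 := by rw [hs2]; field_simp
  have hsq : √(2 * v * L) = 2 * L * s := by
    rw [show 2 * v * L = (2 * L * s) ^ 2 by rw [hv']; ring, Real.sqrt_sq (by positivity)]
  have hD : 0 < R / 3 + s := by positivity
  set θ := 1 / (R / 3 + s) with hθ
  have hθ0 : 0 < θ := by positivity
  have hθR : θ * R < 3 := by
    rw [hθ, div_mul_eq_mul_div, div_lt_iff₀ hD]; linarith
  have hJ : Real.exp (∫ ω, θ * W ω ∂μ) ≤ ∫ ω, Real.exp (θ * W ω) ∂μ :=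
    convexOn_exp.map_integral_le Real.continuous_exp.continuousOn isClosed_univ (by simp)
      (hW.const_mul θ) (hint θ)
  rw [integral_const_mul] at hJ
  have h := hJ.trans (hmgf θ hθ0.le hθR)
  rw [← Real.exp_log (zero_lt_one.trans hd), ← Real.exp_add, Real.exp_le_exp, ← hLdef] at h
  have h1 : 1 - θ * R / 3 = θ * s := by
    rw [hθ]; field_simp; ring
  have h2 : θ ^ 2 * v / 2 / (1 - θ * R / 3) = θ * (L * s) := by
    rw [h1, hv']; field_simp
  have h3 : L = θ * (L * (R / 3 + s)) := by
    rw [hθ]; field_simp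
  rw [h2] at h
  have h4 : θ * ∫ ω, W ω ∂μ ≤ θ * (L * (R / 3 + s) + L * s) := by
    rw [mul_add, ← h3]; exact h
  rw [hsq]
  linarith [le_of_mul_le_mul_left h4 hθ0]

end Bernstein

/-! ### The summands of the measurement matrix -/

section ChirpMatrices

/-- Orthogonality of the rows of the Fourier matrix. -/
lemma toneMatrix_mul_conjTranspose {M N : ℕ} (hM : 0 < M) (hMN : M ≤ N) {Nc : ℝ} (hNc : 0 < Nc) :
    toneMatrix M N Nc * (toneMatrix M N Nc)ᴴ =
      (((N : ℝ) / (M * Nc) : ℝ) : ℂ) • (1 : Matrix (Fin M) (Fin M) ℂ) := by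
  have hN : (N : ℂ) ≠ 0 := Nat.cast_ne_zero.2 (by omega)
  have hMNc : (0 : ℝ) < M * Nc := by positivity
  ext k l
  set z : ℂ := Complex.exp (-(2 * Real.pi * Complex.I * (((k : ℕ) - (l : ℕ) : ℂ) / N))) with hz
  have hterm : ∀ r : Fin N, toneMatrix M N Nc k r * (toneMatrix M N Nc)ᴴ r l =
      ((1 / ((M : ℝ) * Nc) : ℝ) : ℂ) * z ^ (r : ℕ) := fun r => by
    have hsq : ((1 / √((M : ℝ) * Nc) : ℝ) : ℂ) * ((1 / √((M : ℝ) * Nc) : ℝ) : ℂ) =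
        ((1 / ((M : ℝ) * Nc) : ℝ) : ℂ) := by
      rw [← Complex.ofReal_mul, div_mul_div_comm, one_mul, Real.mul_self_sqrt hMNc.le]
    have hexp : z ^ (r : ℕ) =
        Complex.exp (-(2 * Real.pi * Complex.I * ((r : ℕ) * (k : ℕ) / (N : ℂ)))) *
        Complex.exp (2 * Real.pi * Complex.I * ((r : ℕ) * (l : ℕ) / (N : ℂ))) := by
      rw [hz, ← Complex.exp_nat_mul, ← Complex.exp_add]
      congr 1
      field_simp
      ring
    rw [hexp, ← hsq]
    simp only [toneMatrix, conjTranspose_apply, of_apply, Complex.star_def, map_mul,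
      Complex.conj_ofReal, ← Complex.exp_conj, map_neg, map_div₀, Complex.conj_I, map_natCast,
      map_ofNat, mul_neg, neg_mul, neg_neg]
    ring
  rw [mul_apply, Finset.sum_congr rfl fun r _ => hterm r, ← Finset.mul_sum,
    Fin.sum_univ_eq_sum_range (fun r => z ^ r) N, Matrix.smul_apply, one_apply, smul_eq_mul]
  split_ifs with hkl
  · have : z = 1 := by simp [hz, hkl]
    simp [this]
    ring
  · have hzN : z ^ N = 1 := by
      rw [hz, ← Complex.exp_nat_mul, Complex.exp_eq_one_iff]
      refine ⟨(l : ℕ) - (k : ℕ), ?_⟩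
      push_cast
      field_simp
      ring
    have hz1 : z ≠ 1 := by
      intro h
      rw [hz, Complex.exp_eq_one_iff] at h
      obtain ⟨m, hm⟩ := h
      have h2 : ((l : ℕ) : ℂ) - (k : ℕ) = m * N := by
        have hpi := Complex.two_pi_I_ne_zero
        have : (2 * Real.pi * Complex.I) * ((((l : ℕ) : ℂ) - (k : ℕ)) / N) =
            (2 * Real.pi * Complex.I) * m := by
          rw [mul_comm _ (m : ℂ), ← hm]; ring
        rw [← mul_left_cancel₀ hpi this]
        field_simp
      have h3 : ((l : ℕ) : ℤ) - (k : ℕ) = m * N := by exact_mod_cast h2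
      have hk := k.2
      have hl := l.2
      have hm0 : m = 0 := by
        by_contra hm0
        have : (N : ℤ) ≤ |m * N| := by
          rw [abs_mul, Nat.abs_cast]
          exact le_mul_of_one_le_left (by positivity) (Int.one_le_abs hm0)
        rw [← h3] at this
        have : |((l : ℕ) : ℤ) - (k : ℕ)| < N := by rw [abs_lt]; omega
        omega
      rw [hm0] at h3
      exact hkl (Fin.ext (by omega))
    have : ∑ r ∈ Finset.range N, z ^ r = 0 := by
      rw [geom_sum_eq hz1, hzN, sub_self, zero_div]
    simp [this]

lemma freqShift_mul_conjTranspose (M : ℕ) (p : ℤ) (i : ℕ) :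
    freqShift M p i * (freqShift M p i)ᴴ = 1 := by
  rw [freqShift, diagonal_conjTranspose, diagonal_mul_diagonal, ← diagonal_one]
  congr 1
  funext k
  simp [← Complex.exp_conj, ← Complex.exp_add, map_ofNat]

lemma delayPhase_mul_conjTranspose (N i : ℕ) :
    delayPhase N i * (delayPhase N i)ᴴ = 1 := by
  rw [delayPhase, diagonal_conjTranspose, diagonal_mul_diagonal, ← diagonal_one]
  congr 1
  funext k
  simp [← Complex.exp_conj, ← Complex.exp_add, map_ofNat]

/-- Every summand of the measurement matrix is a multiple of a coisometry. -/
lemma chirp_mul_conjTranspose {M N : ℕ} (hM : 0 < M) (hMN : M ≤ N) {Nc : ℝ} (hNc : 0 < Nc) (p : ℤ)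
    (i : ℕ) :
    (freqShift M p i * toneMatrix M N Nc * delayPhase N i) *
        (freqShift M p i * toneMatrix M N Nc * delayPhase N i)ᴴ =
      (√((N : ℝ) / (M * Nc)) ^ 2) • (1 : Matrix (Fin M) (Fin M) ℂ) := by
  rw [Real.sq_sqrt (by positivity), conjTranspose_mul, Matrix.mul_assoc _ (delayPhase N i),
    ← Matrix.mul_assoc (delayPhase N i), delayPhase_mul_conjTranspose, Matrix.one_mul,
    conjTranspose_mul, Matrix.mul_assoc, ← Matrix.mul_assoc (toneMatrix M N Nc),
    toneMatrix_mul_conjTranspose hM hMN hNc, Matrix.smul_mul, Matrix.one_mul, Matrix.mul_smul,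
    freqShift_mul_conjTranspose, Complex.coe_smul]

end ChirpMatrices

/-! ### The random coefficients -/

section Coefficients

variable {Ω : Type*} [MeasurableSpace Ω] {μ : Measure Ω} [IsProbabilityMeasure μ]

/-- Two values whose probabilities add up to `1` are almost surely the only ones. -/
lemma ae_eq_or_eq {X : Ω → ℝ} (hX : Measurable X) {a b : ℝ} (hab : a ≠ b)
    (h : μ.real {ω | X ω = a} + μ.real {ω | X ω = b} = 1) : ∀ᵐ ω ∂μ, X ω = a ∨ X ω = b := by
  have ha : MeasurableSet {ω | X ω = a} := hX (measurableSet_singleton a)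
  have hb : MeasurableSet {ω | X ω = b} := hX (measurableSet_singleton b)
  have hd : Disjoint {ω | X ω = a} {ω | X ω = b} :=
    Set.disjoint_left.2 fun ω h1 h2 => hab (h1.symm.trans h2)
  rw [← measureReal_union hd hb] at h
  refine (mem_ae_iff_prob_eq_one₀ (ha.union hb).nullMeasurableSet).2 ?_
  rw [← ENNReal.toReal_eq_one_iff]
  exact h

omit [IsProbabilityMeasure μ] in
lemma integral_sq_of_zero_or_one {X : Ω → ℝ} (hX : Measurable X)
    (h : ∀ᵐ ω ∂μ, X ω = 0 ∨ X ω = 1) : ∫ ω, X ω ^ 2 ∂μ = μ.real {ω | X ω = 1} := by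
  have h1 : MeasurableSet {ω | X ω = 1} := hX (measurableSet_singleton 1)
  rw [← integral_indicator_one h1]
  refine integral_congr_ae ?_
  filter_upwards [h] with ω hω
  rcases hω with h | h <;> simp [Set.indicator, h]

lemma integral_of_neg_one_or_one {X : Ω → ℝ} (hX : Measurable X)
    (h : ∀ᵐ ω ∂μ, X ω = -1 ∨ X ω = 1) :
    ∫ ω, X ω ∂μ = μ.real {ω | X ω = 1} - μ.real {ω | X ω = -1} := by
  have h1 : MeasurableSet {ω | X ω = 1} := hX (measurableSet_singleton 1)
  have h2 : MeasurableSet {ω | X ω = -1} := hX (measurableSet_singleton (-1))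
  rw [← integral_indicator_one h1, ← integral_indicator_one h2, ← integral_sub
    ((integrable_const 1).indicator h1) ((integrable_const 1).indicator h2)]
  refine integral_congr_ae ?_
  filter_upwards [h] with ω hω
  rcases hω with h | h <;> norm_num [Set.indicator, h]

omit [IsProbabilityMeasure μ] in
/-- The products `γ i * ξ i` with `i ∈ s` are independent of the one at `j ∉ s`: the two
families are functions of the members of `Sum.elim γ ξ` on disjoint index sets. -/
lemma indepFun_mul_of_notMem {ι : Type*} [DecidableEq ι] {γ ξ : ι → Ω → ℝ}
    (hγm : ∀ i, Measurable (γ i)) (hξm : ∀ i, Measurable (ξ i))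
    (hindep : iIndepFun (Sum.elim γ ξ) μ) (s : Finset ι) {j : ι} (hj : j ∉ s) :
    IndepFun (fun ω (i : s) => γ i ω * ξ i ω) (fun ω => γ j ω * ξ j ω) μ := by
  have hm : ∀ i, Measurable (Sum.elim γ ξ i) := by rintro (i | i); exacts [hγm i, hξm i]
  have hd : Disjoint (s.disjSum s) (({j} : Finset ι).disjSum {j}) := by
    rw [Finset.disjoint_left]
    rintro (i | i) h1 h2
    · simp only [Finset.inl_mem_disjSum, Finset.mem_singleton] at h1 h2
      exact hj (h2 ▸ h1)
    · simp only [Finset.inr_mem_disjSum, Finset.mem_singleton] at h1 h2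
      exact hj (h2 ▸ h1)
  have h := hindep.indepFun_finset _ _ hd hm
  let f : (s.disjSum s → ℝ) → (s → ℝ) := fun a i =>
    a ⟨Sum.inl i, Finset.inl_mem_disjSum.2 i.2⟩ * a ⟨Sum.inr i, Finset.inr_mem_disjSum.2 i.2⟩
  let g : (({j} : Finset ι).disjSum {j} → ℝ) → ℝ := fun a =>
    a ⟨Sum.inl j, by simp⟩ * a ⟨Sum.inr j, by simp⟩
  exact h.comp (φ := f) (ψ := g) (by fun_prop) (by fun_prop)

end Coefficients

/-! ### The measurement matrix -/

lemma hermitianDilation_measurementMatrix (M N : ℕ) (Nc : ℝ) (p : ℤ) (c : Fin N → ℝ) :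
    hermitianDilation (measurementMatrix M N Nc p c) =
      ∑ i, c i • hermitianDilation (freqShift M p i * toneMatrix M N Nc * delayPhase N i) := by
  ext (a | a) (b | b) <;>
    simp [hermitianDilation, measurementMatrix, Matrix.sum_apply, -conjTranspose_mul]

lemma continuous_measurementMatrix (M N : ℕ) (Nc : ℝ) (p : ℤ) :
    Continuous (measurementMatrix M N Nc p) := by
  unfold measurementMatrix
  fun_prop

end MultiChirp

open MultiChirp in
/-- `γ i` selects the `i`-th chirp with probability `N_c / N`, `ξ i` is a random sign, and all
these random variables are jointly independent. The norm is the `ℓ² → ℓ²` operator norm. -/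
theorem lemma1 {Ω : Type*} [MeasurableSpace Ω] (μ : Measure Ω) [IsProbabilityMeasure μ]
    (M N : ℕ) (hM : 0 < M) (hMN : M ≤ N)
    (Nc : ℝ) (hNc : 0 < Nc) (hNcN : Nc ≤ N) (p : ℤ)
    (γ ξ : Fin N → Ω → ℝ)
    (hγm : ∀ i, Measurable (γ i)) (hξm : ∀ i, Measurable (ξ i))
    (hγ0 : ∀ i, μ.real {ω | γ i ω = 0} = 1 - Nc / N)
    (hγ1 : ∀ i, μ.real {ω | γ i ω = 1} = Nc / N)
    (hξneg : ∀ i, μ.real {ω | ξ i ω = -1} = 1 / 2)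
    (hξpos : ∀ i, μ.real {ω | ξ i ω = 1} = 1 / 2)
    (hindep : iIndepFun (Sum.elim γ ξ) μ) :
    (4 / 9 * Real.log ((N : ℝ) + M) ≤ Nc →
      μ.real {ω | 2 * √((N : ℝ) * Real.log ((N : ℝ) + M) / M) ≤
          ‖MultiChirp.measurementMatrix M N Nc p (fun i => γ i ω * ξ i ω)‖} ≤
        (1 / ((N : ℝ) + M)) ^ (MultiChirp.alphaTwo M N Nc - 1)) ∧
    Integrable
      (fun ω => ‖MultiChirp.measurementMatrix M N Nc p (fun i => γ i ω * ξ i ω)‖) μ ∧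
    ∫ ω, ‖MultiChirp.measurementMatrix M N Nc p (fun i => γ i ω * ξ i ω)‖ ∂μ ≤
      √(2 * (N : ℝ) / M * Real.log ((N : ℝ) + M)) +
        Real.log ((N : ℝ) + M) / 3 * √((N : ℝ) / ((M : ℝ) * Nc)) := by
  have hN : 0 < N := hM.trans_le hMN
  have hM' : (0 : ℝ) < M := Nat.cast_pos.2 hM
  have hN' : (0 : ℝ) < N := Nat.cast_pos.2 hN
  have : Nonempty (Fin M) := ⟨⟨0, hM⟩⟩
  have hd : (1 : ℝ) < N + M := by
    have : (1 : ℝ) ≤ M := Nat.one_le_cast.2 hM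
    linarith
  have hL : 0 < Real.log ((N : ℝ) + M) := Real.log_pos hd
  set R := √((N : ℝ) / (M * Nc)) with hRdef
  have hR : 0 < R := Real.sqrt_pos.2 (by positivity)
  have hR2 : R ^ 2 = N / (M * Nc) := Real.sq_sqrt (by positivity)
  let c : Fin N → Ω → ℝ := fun i ω => γ i ω * ξ i ω
  have hcm : ∀ i, Measurable (c i) := fun i => (hγm i).mul (hξm i)
  have hγ : ∀ i, ∀ᵐ ω ∂μ, γ i ω = 0 ∨ γ i ω = 1 := fun i =>
    ae_eq_or_eq (hγm i) zero_ne_one (by rw [hγ0, hγ1]; ring)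
  have hξ : ∀ i, ∀ᵐ ω ∂μ, ξ i ω = -1 ∨ ξ i ω = 1 := fun i =>
    ae_eq_or_eq (hξm i) (by norm_num) (by rw [hξneg, hξpos]; norm_num)
  have hc : ∀ i, ∀ᵐ ω ∂μ, c i ω = -1 ∨ c i ω = 0 ∨ c i ω = 1 := fun i => by
    filter_upwards [hγ i, hξ i] with ω h1 h2
    rcases h1 with h1 | h1 <;> rcases h2 with h2 | h2 <;> simp [c, h1, h2]
  have hbd : ∀ i, ∀ᵐ ω ∂μ, |c i ω| ≤ 1 := fun i => by
    filter_upwards [hc i] with ω hω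
    rcases hω with h | h | h <;> simp [h]
  have hc1 : ∀ i, ∫ ω, c i ω ∂μ = 0 := fun i => by
    have h : IndepFun (γ i) (ξ i) μ := hindep.indepFun (i := Sum.inl i) (j := Sum.inr i) (by simp)
    rw [h.integral_fun_mul_eq_mul_integral (hγm i).aestronglyMeasurable
      (hξm i).aestronglyMeasurable, integral_of_neg_one_or_one (hξm i) (hξ i), hξneg, hξpos,
      sub_self, mul_zero]
  have hc2 : ∀ i, ∫ ω, c i ω ^ 2 ∂μ = Nc / N := fun i => by
    rw [← hγ1 i, ← integral_sq_of_zero_or_one (hγm i) (hγ i)]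
    refine integral_congr_ae ?_
    filter_upwards [hξ i] with ω hω
    rcases hω with h | h <;> simp [c, h]
  let B : Fin N → Matrix (Fin M) (Fin N) ℂ := fun i =>
    freqShift M p i * toneMatrix M N Nc * delayPhase N i
  let W : Ω → ℝ := fun ω => ‖measurementMatrix M N Nc p (fun i => c i ω)‖
  have hWc := continuous_measurementMatrix M N Nc p
  have hWi : Integrable W μ := integrable_comp_of_continuous hcm hbd hWc.norm
  have hint : ∀ θ : ℝ, Integrable (fun ω => Real.exp (θ * W ω)) μ := fun θ =>
    integrable_comp_of_continuous hcm hbd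
      (F := fun a => Real.exp (θ * ‖measurementMatrix M N Nc p a‖)) (by fun_prop)
  have hmgf : ∀ θ : ℝ, 0 ≤ θ → θ * R < 3 → ∫ ω, Real.exp (θ * W ω) ∂μ ≤
      ((N : ℝ) + M) * Real.exp (θ ^ 2 * (N / M) / 2 / (1 - θ * R / 3)) := by
    intro θ hθ hθR
    have hX : ∀ i, (θ • hermitianDilation (B i)).IsHermitian := fun i => by
      simp [Matrix.IsHermitian, Matrix.conjTranspose_smul, (isHermitian_hermitianDilation (B i)).eq]
    have hXn : ∀ i, ‖θ • hermitianDilation (B i)‖ ≤ θ * R := fun i => by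
      rw [norm_smul, Real.norm_of_nonneg hθ]
      exact mul_le_mul_of_nonneg_left
        (norm_hermitianDilation_le hR.le (chirp_mul_conjTranspose hM hMN hNc p i)) hθ
    have hsum : ∀ ω, θ • hermitianDilation (measurementMatrix M N Nc p fun i => c i ω) =
        ∑ i, c i ω • θ • hermitianDilation (B i) := fun ω => by
      rw [hermitianDilation_measurementMatrix, Finset.smul_sum]
      exact Finset.sum_congr rfl fun i _ => smul_comm _ _ _
    have hcosh : 0 ≤ Real.cosh (θ * R) - 1 := by linarith [Real.one_le_cosh (θ * R)]
    calc ∫ ω, Real.exp (θ * W ω) ∂μ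
        ≤ ∫ ω, (Matrix.trace (NormedSpace.exp (∑ i, c i ω • θ • hermitianDilation (B i)))).re ∂μ := by
          refine integral_mono (hint θ) (integrable_comp_of_continuous hcm hbd
            (F := fun a => (Matrix.trace (NormedSpace.exp
              (∑ i, a i • θ • hermitianDilation (B i)))).re) ?_) fun ω => ?_
          · simpa [Function.comp_def] using (continuous_re_trace_exp_mul 1).comp
              (continuous_sum_smul Finset.univ fun i => θ • hermitianDilation (B i))
          · rw [← hsum]
            exact exp_norm_le_re_trace_exp _ hθ
      _ ≤ Fintype.card (Fin M ⊕ Fin N) *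
            (1 + Nc / N * (Real.cosh (θ * R) - 1)) ^ (Finset.univ : Finset (Fin N)).card :=
          integral_re_trace_exp_sum_le hcm hc
            (fun s j hj => indepFun_mul_of_notMem hγm hξm hindep s hj) hc1 hc2 hX hXn _
      _ = (N + M) * (1 + Nc / N * (Real.cosh (θ * R) - 1)) ^ N := by
          simp [add_comm]
      _ ≤ (N + M) * Real.exp (Nc / N * (Real.cosh (θ * R) - 1)) ^ N := by
          gcongr
          linarith [Real.add_one_le_exp (Nc / N * (Real.cosh (θ * R) - 1))]
      _ = (N + M) * Real.exp (Nc * (Real.cosh (θ * R) - 1)) := by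
          rw [← Real.exp_nat_mul]
          congr 2
          field_simp
      _ ≤ (N + M) * Real.exp (Nc * ((θ * R) ^ 2 / 2 / (1 - θ * R / 3))) := by
          gcongr
          exact cosh_sub_one_le (by positivity) hθR
      _ = _ := by
          rw [mul_pow, hR2]
          congr 2
          field_simp
  have hv : (0 : ℝ) < N / M := by positivity
  refine ⟨fun _ => ?_, hWi, ?_⟩
  · refine (bernstein_tail hv hR hint hmgf (by positivity)).trans_eq ?_
    set L := Real.log ((N : ℝ) + M) with hLdef
    set s := √(L / Nc) with hs
    have ht2 : (2 * √((N : ℝ) * L / M)) ^ 2 = 4 * (N * L / M) := by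
      rw [mul_pow, Real.sq_sqrt (by positivity)]; norm_num
    have hRt : R * (2 * √((N : ℝ) * L / M)) = 2 * (N / M * s) := by
      rw [mul_left_comm, hRdef, ← Real.sqrt_mul (by positivity)]
      congr 1
      rw [show (N : ℝ) / (M * Nc) * (N * L / M) = (N / M) ^ 2 * (L / Nc) by field_simp,
        Real.sqrt_mul (by positivity), Real.sqrt_sq (by positivity)]
    have hs0 : 0 ≤ s := Real.sqrt_nonneg _
    have hexp : (2 * √((N : ℝ) * L / M)) ^ 2 / 2 / (N / M + R * (2 * √((N : ℝ) * L / M)) / 3) =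
        L * alphaTwo M N Nc := by
      rw [ht2, hRt, alphaTwo, ← hLdef, ← hs]
      field_simp
      ring
    have hd0 : (0 : ℝ) < N + M := by positivity
    rw [hexp, Real.rpow_def_of_pos (by positivity), one_div, Real.log_inv, ← hLdef]
    nth_rewrite 1 [← Real.exp_log hd0]
    rw [← hLdef, ← Real.exp_add]
    congr 1
    ring
  · refine (bernstein_mean hd hv hR hWi hint hmgf).trans_eq ?_
    rw [mul_div_assoc 2]
    ring
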